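/- Let $d\ge 2$ be an integer and let $\mathcal{O}_d$ be the Cuntz algebra, i.e. the universal unital $C^*$-algebra generated by elements $s_1,\dots,s_d$ with $s_i^*s_j=\delta_{ij}1$ and $\sum_{i=1}^d s_is_i^*=1$. For $L=(L_1,\dots,L_d)\in\mathbb{R}^d$ let $\sigma^L=(\sigma^L_t)_{t\in\mathbb{R}}$ be the one-parameter group of $*$-automorphisms of $\mathcal{O}_d$ determined by $\sigma^L_t(s_j)=e^{itL_j}s_j$. For $\beta\in\mathbb{R}$, a state $\omega$ of $\mathcal{O}_d$ is called a $\sigma^L$-KMS state at value $\beta$ if $\omega(x\,\sigma^L_{i\beta}(y))=\omega(yx)$ for all $x,y$ in some norm-dense $\sigma^L$-invariant $*$-subalgebra of $\mathcal{O}_d$ consisting of $\sigma^L$-analytic elements; here $y$ is $\sigma^L$-analytic if $t\mapsto\sigma^L_t(y)$ extends to an entire function $z\mapsto\sigma^L_z(y)$ from $\mathbb{C}$ to $\mathcal{O}_d$. Then $\sigma^L$ admits a KMS state at some value $\beta\in\mathbb{R}$ if and only if $L_1,\dots,L_d$ are all nonzero and have the same sign. In that case the equation $\sum_{k=1}^d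 e^{-\beta L_k}=1$ has exactly one real solution $\beta$, this $\beta$ is the only value at which $\sigma^L$ admits a KMS state, and the $\sigma^L$-KMS state $\omega$ at this value is unique and satisfies $$\omega(s_\alpha s_\gamma^*)=\delta_{\alpha\gamma}\,e^{-\beta\sum_{k=1}^{|\alpha|}L_{\alpha_k}}$$ for all finite (possibly empty) words $\alpha,\gamma$ in $\{1,\dots,d\}$, where $s_\alpha=s_{\alpha_1}\cdots s_{\alpha_k}$ for $\alpha=(\alpha_1,\dots,\alpha_k)$ and $s_\emptyset=1$. -/

import Mathlib

open scoped ENNReal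

noncomputable section

namespace Cuntz

/-- A Cuntz family: `S_i^* S_j = δ_{ij} 1` and `∑_i S_i S_i^* = 1`. -/
structure IsCuntzFamily {d : ℕ} {A : Type*} [Ring A] [StarRing A] (S : Fin d → A) : Prop where
  star_mul : ∀ i j, star (S i) * S j = if i = j then 1 else 0
  sum_mul_star : ∑ i, S i * star (S i) = 1

/-- A nonzero unital C⋆-algebra together with a Cuntz family in it. -/
structure CuntzRep (d : ℕ) : Type 1 where
  carrier : Type
  [cstar : CStarAlgebra carrier]
  [nontriv : Nontrivial carrier]
  S : Fin d → carrier
  isCuntz : IsCuntzFamily S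

attribute [instance] CuntzRep.cstar CuntzRep.nontriv

theorem IsCuntzFamily.norm_le_one {d : ℕ} {A : Type*} [CStarAlgebra A] [Nontrivial A]
    {S : Fin d → A} (hS : IsCuntzFamily S) (i : Fin d) : ‖S i‖ ≤ 1 := by
  have h : ‖S i‖ * ‖S i‖ = 1 := by
    rw [← CStarRing.norm_star_mul_self, hS.star_mul]
    simp
  nlinarith [norm_nonneg (S i)]

/-- The `ℓ^∞`-direct sum of all C⋆-algebras carrying a Cuntz family. -/
abbrev BigSum (d : ℕ) : Type 1 := lp (fun ρ : CuntzRep d => ρ.carrier) ∞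

instance (d : ℕ) : CStarAlgebra (BigSum d) where

/-- The direct sum of all Cuntz families. -/
def bigGen {d : ℕ} (i : Fin d) : BigSum d :=
  ⟨fun ρ => ρ.S i, memℓp_infty ⟨1, by
    rintro _ ⟨ρ, rfl⟩
    exact ρ.isCuntz.norm_le_one i⟩⟩

/-- The closed unital ⋆-subalgebra generated by the direct sum of all Cuntz families. -/
def cuntzSubalgebra (d : ℕ) : StarSubalgebra ℂ (BigSum d) :=
  (StarAlgebra.adjoin ℂ (Set.range (bigGen (d := d)))).topologicalClosure

/-- The Cuntz algebra `𝒪_d`: the universal unital C⋆-algebra generated by a Cuntz family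
`s_1, …, s_d`, realized as the C⋆-algebra generated by the direct sum of all Cuntz families.
(A C⋆-algebra generated by a Cuntz family is separable, hence isomorphic to one whose carrier lies
in the lowest universe, so that indeed every Cuntz family is taken into account.) The universal
property is `CuntzAlgebra.existsUnique_lift`. -/
def CuntzAlgebra (d : ℕ) : Type 1 := cuntzSubalgebra d

namespace CuntzAlgebra

variable {d : ℕ}

instance : CStarAlgebra (CuntzAlgebra d) :=
  StarSubalgebra.cstarAlgebra (cuntzSubalgebra d)
    (h_closed := StarSubalgebra.isClosed_topologicalClosure _)

/-- The inclusion of `𝒪_d` in the direct sum. -/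
def incl : CuntzAlgebra d →⋆ₐ[ℂ] BigSum d := (cuntzSubalgebra d).subtype

theorem incl_injective : Function.Injective (incl (d := d)) := Subtype.val_injective

theorem norm_incl (x : CuntzAlgebra d) : ‖incl x‖ = ‖x‖ := rfl

/-- The generators `s_i` of `𝒪_d`. -/
def s (i : Fin d) : CuntzAlgebra d :=
  ⟨bigGen i, StarSubalgebra.le_topologicalClosure _
    (StarAlgebra.subset_adjoin ℂ _ (Set.mem_range_self i))⟩

theorem incl_s (i : Fin d) : incl (s i) = bigGen i := rfl

/-- The coordinate of `𝒪_d` at a given Cuntz family. -/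
def eval (ρ : CuntzRep d) : CuntzAlgebra d →⋆ₐ[ℂ] ρ.carrier where
  toFun x := incl x ρ
  map_one' := rfl
  map_mul' _ _ := rfl
  map_zero' := rfl
  map_add' _ _ := rfl
  commutes' _ := rfl
  map_star' _ := rfl

theorem eval_s (ρ : CuntzRep d) (i : Fin d) : eval ρ (s i) = ρ.S i := rfl

theorem ext_eval {x y : CuntzAlgebra d} (h : ∀ ρ : CuntzRep d, eval ρ x = eval ρ y) : x = y :=
  incl_injective (Subtype.ext (funext h))

theorem isCuntzFamily_s : IsCuntzFamily (s (d := d)) where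
  star_mul i j := ext_eval fun ρ => by
    rw [map_mul, map_star, eval_s, eval_s, ρ.isCuntz.star_mul]
    split_ifs <;> simp
  sum_mul_star := ext_eval fun ρ => by
    simp only [map_sum, map_mul, map_star, eval_s, ρ.isCuntz.sum_mul_star, map_one]

theorem continuous_starAlgHom {A B : Type*} [CStarAlgebra A] [CStarAlgebra B]
    (f : A →⋆ₐ[ℂ] B) : Continuous f :=
  AddMonoidHomClass.continuous_of_bound f 1 fun x => by
    simpa using NonUnitalStarAlgHom.norm_apply_le f x

/-- `𝒪_d` is generated by `s_1, …, s_d` as a C⋆-algebra. -/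
theorem dense_adjoin_s :
    Dense (StarAlgebra.adjoin ℂ (Set.range (s (d := d))) : Set (CuntzAlgebra d)) := by
  have hind : Topology.IsInducing (incl (d := d)) := Topology.IsInducing.subtypeVal
  have himg : (StarAlgebra.adjoin ℂ (Set.range (s (d := d)))).map incl =
      StarAlgebra.adjoin ℂ (Set.range (bigGen (d := d))) := by
    rw [StarAlgHom.map_adjoin, ← Set.range_comp]
    rfl
  intro x
  rw [hind.closure_eq_preimage_closure_image, Set.mem_preimage, ← StarSubalgebra.coe_map, himg]
  exact x.2

/-- Two unital ⋆-homomorphisms on `𝒪_d` that agree on the generators are equal. -/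
theorem hom_ext {B : Type*} [CStarAlgebra B] {f g : CuntzAlgebra d →⋆ₐ[ℂ] B}
    (h : ∀ i, f (s i) = g (s i)) : f = g := by
  have hle : StarAlgebra.adjoin ℂ (Set.range (s (d := d))) ≤ StarAlgHom.equalizer f g :=
    StarAlgebra.adjoin_le (by rintro _ ⟨i, rfl⟩; exact h i)
  exact DFunLike.ext' (Continuous.ext_on dense_adjoin_s (continuous_starAlgHom f)
    (continuous_starAlgHom g) fun x hx => hle hx)

/-- The universal property of `𝒪_d`. -/
theorem existsUnique_lift {B : Type} [CStarAlgebra B] [Nontrivial B] (S : Fin d → B)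
    (hS : IsCuntzFamily S) : ∃! f : CuntzAlgebra d →⋆ₐ[ℂ] B, ∀ i, f (s i) = S i :=
  ⟨eval ⟨B, S, hS⟩, fun _ => rfl, fun _ hf => hom_ext fun i => (hf i).trans rfl⟩

/-! ### The action of the torus -/

/-- The Cuntz family `z_1 S_1, …, z_d S_d`. -/
def twist (z : Fin d → Circle) (ρ : CuntzRep d) : CuntzRep d where
  carrier := ρ.carrier
  S i := (z i : ℂ) • ρ.S i
  isCuntz :=
    { star_mul := fun i j => by
        rw [star_smul, smul_mul_smul_comm, ρ.isCuntz.star_mul]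
        split_ifs with h
        · subst h
          have : star (z i : ℂ) * (z i : ℂ) = 1 := by
            rw [Complex.star_def, ← Circle.coe_inv_eq_conj, ← Circle.coe_mul]; simp
          rw [this, one_smul]
        · rw [smul_zero]
      sum_mul_star := by
        rw [← ρ.isCuntz.sum_mul_star]
        refine Finset.sum_congr rfl fun i _ => ?_
        have : (z i : ℂ) * star (z i : ℂ) = 1 := by
          rw [Complex.star_def, ← Circle.coe_inv_eq_conj, ← Circle.coe_mul]; simp
        rw [star_smul, smul_mul_smul_comm, this, one_smul] }

/-- The coordinate of the pulled back element at `ρ` is the coordinate at `twist z ρ`. -/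
def pull (z : Fin d → Circle) : BigSum d →⋆ₐ[ℂ] BigSum d where
  toFun x := ⟨fun ρ => x (twist z ρ), memℓp_infty ⟨‖x‖, by
    rintro _ ⟨ρ, rfl⟩
    exact lp.norm_apply_le_norm ENNReal.top_ne_zero x (twist z ρ)⟩⟩
  map_one' := rfl
  map_mul' _ _ := rfl
  map_zero' := rfl
  map_add' _ _ := rfl
  commutes' _ := rfl
  map_star' _ := rfl

theorem pull_bigGen (z : Fin d → Circle) (i : Fin d) :
    pull z (bigGen i) = (z i : ℂ) • bigGen i := rfl

theorem pull_mem (z : Fin d → Circle) {x : BigSum d} (hx : x ∈ cuntzSubalgebra d) :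
    pull z x ∈ cuntzSubalgebra d := by
  have h1 : StarAlgebra.adjoin ℂ (Set.range (bigGen (d := d))) ≤
      (cuntzSubalgebra d).comap (pull z) := by
    refine StarAlgebra.adjoin_le ?_
    rintro _ ⟨i, rfl⟩
    exact (cuntzSubalgebra d).smul_mem (s i).2 (z i : ℂ)
  have h2 : IsClosed ((cuntzSubalgebra d).comap (pull z) : Set (BigSum d)) :=
    (StarSubalgebra.isClosed_topologicalClosure _).preimage (continuous_starAlgHom (pull z))
  exact StarSubalgebra.topologicalClosure_minimal h1 h2 hx

/-- The unital ⋆-endomorphism of `𝒪_d` with `s_i ↦ z_i s_i`. -/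
def torusHom (z : Fin d → Circle) : CuntzAlgebra d →⋆ₐ[ℂ] CuntzAlgebra d where
  toFun x := ⟨pull z (incl x), pull_mem z x.2⟩
  map_one' := rfl
  map_mul' _ _ := rfl
  map_zero' := rfl
  map_add' _ _ := rfl
  commutes' _ := rfl
  map_star' _ := rfl

theorem torusHom_s (z : Fin d → Circle) (i : Fin d) : torusHom z (s i) = (z i : ℂ) • s i := rfl

theorem torusHom_mul (z w : Fin d → Circle) :
    torusHom (z * w) = (torusHom z).comp (torusHom w) :=
  hom_ext fun i => by
    rw [StarAlgHom.comp_apply, torusHom_s, torusHom_s, map_smul, torusHom_s, smul_smul,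
      Pi.mul_apply, Circle.coe_mul, mul_comm]

theorem torusHom_one : torusHom (1 : Fin d → Circle) = StarAlgHom.id ℂ (CuntzAlgebra d) :=
  hom_ext fun i => by
    rw [torusHom_s, StarAlgHom.coe_id, Pi.one_apply, Circle.coe_one, one_smul, id_eq]

/-- The action `σ` of the torus on `𝒪_d` by ⋆-automorphisms, `σ(z)(s_i) = z_i s_i`. -/
def torusAction (d : ℕ) : (Fin d → Circle) →* (CuntzAlgebra d ≃⋆ₐ[ℂ] CuntzAlgebra d) where
  toFun z := StarAlgEquiv.ofStarAlgHom (torusHom z) (torusHom z⁻¹)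
    (by rw [← torusHom_mul, inv_mul_cancel, torusHom_one])
    (by rw [← torusHom_mul, mul_inv_cancel, torusHom_one])
  map_one' := StarAlgEquiv.ext fun x => DFunLike.congr_fun torusHom_one x
  map_mul' z w := StarAlgEquiv.ext fun x => DFunLike.congr_fun (torusHom_mul z w) x

theorem torusAction_s (z : Fin d → Circle) (i : Fin d) :
    torusAction d z (s i) = (z i : ℂ) • s i := rfl

/-- The one-parameter group `σ^L_t = σ(e^{itL_1}, …, e^{itL_d})`. -/
def flow (L : Fin d → ℝ) :
    Multiplicative ℝ →* (CuntzAlgebra d ≃⋆ₐ[ℂ] CuntzAlgebra d) where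
  toFun t := torusAction d fun i => Circle.exp (t.toAdd * L i)
  map_one' := by
    rw [← map_one (torusAction d)]
    congr 1
    funext i
    simp
  map_mul' t u := by
    rw [← map_mul]
    congr 1
    funext i
    simp [add_mul, Circle.exp_add]

theorem flow_s (L : Fin d → ℝ) (t : ℝ) (i : Fin d) :
    flow L (Multiplicative.ofAdd t) (s i) = Complex.exp (Complex.I * t * L i) • s i := by
  change ((Circle.exp (t * L i) : Circle) : ℂ) • s i = _
  rw [Circle.coe_exp]
  congr 2
  push_cast
  ring

/-- The word `s_α = s_{α_1} ⋯ s_{α_k}`, with `s_∅ = 1`. -/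
def word (α : List (Fin d)) : CuntzAlgebra d := (α.map s).prod

end CuntzAlgebra

/-! ### States and the KMS condition -/

section KMS

open scoped ComplexOrder

variable {A : Type*} [CStarAlgebra A]

/-- A state of a unital C⋆-algebra: a positive linear functional with `ω(1) = 1`. -/
structure IsState (ω : A →L[ℂ] ℂ) : Prop where
  nonneg : ∀ a : A, 0 ≤ ω (star a * a)
  map_one : ω 1 = 1

/-- `f` is an entire `A`-valued function with `f(t) = σ_t(y)` for real `t`. An element `y` is
`σ`-analytic if such an `f` exists; then `f` is unique and `σ_z(y) = f(z)` for complex `z`. -/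
structure IsEntireExtension (σ : Multiplicative ℝ →* (A ≃⋆ₐ[ℂ] A)) (y : A) (f : ℂ → A) : Prop where
  differentiable : Differentiable ℂ f
  apply_ofReal : ∀ t : ℝ, f t = σ (Multiplicative.ofAdd t) y

/-- `ω` is a `σ`-KMS state at value `β`: it is a state, and `ω(x σ_{iβ}(y)) = ω(y x)` for all
`x`, `y` in some norm-dense `σ`-invariant ⋆-subalgebra of `σ`-analytic elements. -/
structure IsKMSState (σ : Multiplicative ℝ →* (A ≃⋆ₐ[ℂ] A)) (β : ℝ) (ω : A →L[ℂ] ℂ) : Prop where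
  isState : IsState ω
  exists_dense : ∃ D : NonUnitalStarSubalgebra ℂ A,
    Dense (D : Set A) ∧
    (∀ t : ℝ, ∀ y ∈ D, σ (Multiplicative.ofAdd t) y ∈ D) ∧
    (∀ y ∈ D, ∃ f : ℂ → A, IsEntireExtension σ y f) ∧
    ∀ x ∈ D, ∀ y ∈ D, ∀ f : ℂ → A, IsEntireExtension σ y f →
      ω (x * f (Complex.I * β)) = ω (y * x)

end KMS

end Cuntz

end

/-! Write L_α for the sum of the L_k over the letters of α. If the KMS condition holds at y = s_α
for every x, then ω(s_k s_k^*) = e^{-βL_k} ω(s_k^* s_k) = e^{-βL_k}, and summing over k gives ∑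
e^{-βL_k} = 1. Since d ≥ 2, every summand is below 1, so βL_k > 0 for all k: the L_k are nonzero
with a common sign. Moreover ω(s_α s_γ^*) = e^{-βL_α} ω(s_γ^* s_α), and s_γ^* s_α is 1, 0, a
nonempty word or the adjoint of one. On the last two ω vanishes, because they are eigenvectors of
the flow with βλ ≠ 0. This determines ω on a dense span.

The delicate point is that the dense subalgebra in the definition need not contain any s_k, and
approximating s_k by some y in it does not control σ_{iβ}(y). `norm_kms_defect_le` gets around this
by averaging e^{-iλt} times the KMS identity for σ_t(y) over 0 ≤ t ≤ T. By Cauchy's theorem the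
contour shift costs only O(1), which disappears after division by T, and what remains is linear in
‖y - y₀‖. `IsKMSState.apply_eigenvector_mul` then lets y tend to y₀.

For existence, start from a vector state vanishing on s_α s_γ^* whenever |α| ≠ |γ|, and iterate φ ↦
∑ e^{-βL_i} φ(s_i^* · s_i). Each step strips one leading letter from both words, so the values
stabilize and any weak-⋆ cluster point has the required values. These values give the KMS identity
on generators, hence on the ⋆-algebra they generate. -/

namespace Cuntz

/-! ### Entire extensions and the KMS condition at eigenvectors -/

section EntireExtension

variable {A : Type*} [CStarAlgebra A] {σ : Multiplicative ℝ →* (A ≃⋆ₐ[ℂ] A)}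

/-- Two entire functions that agree on the real line are equal. -/
theorem eq_of_differentiable_of_eq_ofReal {f g : ℂ → A} (hf : Differentiable ℂ f)
    (hg : Differentiable ℂ g) (h : ∀ t : ℝ, f t = g t) : f = g := by
  refine AnalyticOnNhd.eq_of_frequently_eq (𝕜 := ℂ) (z₀ := 0)
    (fun z _ => hf.analyticAt z) (fun z _ => hg.analyticAt z) ?_
  have hT : Filter.Tendsto (fun t : ℝ => (t : ℂ)) (nhdsWithin 0 {0}ᶜ) (nhdsWithin 0 {0}ᶜ) := by
    refine tendsto_nhdsWithin_iff.2 ⟨?_, ?_⟩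
    · exact ((Complex.continuous_ofReal.tendsto' 0 0 (by simp)).mono_left nhdsWithin_le_nhds)
    · filter_upwards [self_mem_nhdsWithin] with t ht
      simpa using ht
  exact hT.frequently (Filter.Eventually.frequently (Filter.Eventually.of_forall h))

theorem continuous_starAlgEquiv (e : A ≃⋆ₐ[ℂ] A) : Continuous e :=
  AddMonoidHomClass.continuous_of_bound e 1 fun x => by
    simpa using NonUnitalStarAlgHom.norm_apply_le e x

theorem IsEntireExtension.eq {y : A} {f g : ℂ → A} (hf : IsEntireExtension σ y f)
    (hg : IsEntireExtension σ y g) : f = g :=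
  eq_of_differentiable_of_eq_ofReal hf.differentiable hg.differentiable fun t => by
    rw [hf.apply_ofReal, hg.apply_ofReal]

/-- Both sides are entire in z, since σ_T is bounded and linear, and they agree for real z by the
group law. It makes ‖f‖ bounded along horizontal lines. -/
theorem IsEntireExtension.apply_add_ofReal {y : A} {f : ℂ → A} (hf : IsEntireExtension σ y f)
    (T : ℝ) (z : ℂ) : f (z + T) = σ (Multiplicative.ofAdd T) (f z) := by
  let e : A →L[ℂ] A :=
    { toLinearMap := (σ (Multiplicative.ofAdd T) : A →ₗ[ℂ] A)
      cont := continuous_starAlgEquiv _ }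
  refine congrFun (eq_of_differentiable_of_eq_ofReal (f := fun z => f (z + T))
    (g := fun z => e (f z)) (hf.differentiable.comp (differentiable_id.add_const _))
    (e.differentiable.comp hf.differentiable) fun t => ?_) z
  change f (t + T) = σ (Multiplicative.ofAdd T) (f t)
  rw [← Complex.ofReal_add, hf.apply_ofReal, hf.apply_ofReal, add_comm, ofAdd_add, map_mul]
  rfl

theorem IsEntireExtension.translate {y : A} {f : ℂ → A} (hf : IsEntireExtension σ y f)
    (T : ℝ) : IsEntireExtension σ (σ (Multiplicative.ofAdd T) y) (fun z => f (z + T)) where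
  differentiable := hf.differentiable.comp (differentiable_id.add_const _)
  apply_ofReal t := by
    rw [← Complex.ofReal_add, hf.apply_ofReal, ofAdd_add, map_mul]
    rfl

theorem norm_flow_apply_le (t : ℝ) (y : A) : ‖σ (Multiplicative.ofAdd t) y‖ ≤ ‖y‖ :=
  NonUnitalStarAlgHom.norm_apply_le _ y

/-- The horizontal boundary integrals of a rectangle of fixed height differ by a bounded amount
when the entire integrand is bounded on the vertical sides uniformly in the width. -/
theorem exists_norm_integral_sub_integral_le {g : ℂ → ℂ} (hg : Differentiable ℂ g) (β : ℝ)
    {q : ℝ → ℝ} (hq : Continuous q) (hgq : ∀ T u : ℝ, ‖g (T + u * Complex.I)‖ ≤ q u) :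
    ∃ K : ℝ, ∀ T : ℝ,
      ‖(∫ t in (0 : ℝ)..T, g t) - ∫ t in (0 : ℝ)..T, g (t + β * Complex.I)‖ ≤ K := by
  obtain ⟨C, hC⟩ := (isCompact_uIcc (a := (0 : ℝ)) (b := β)).exists_bound_of_continuousOn
    hq.continuousOn
  have hside : ∀ T : ℝ, ‖∫ u in (0 : ℝ)..β, g (T + u * Complex.I)‖ ≤ C * |β - 0| := fun T =>
    intervalIntegral.norm_integral_le_of_norm_le_const fun u hu =>
      (hgq T u).trans ((Real.le_norm_self _).trans (hC u (Set.uIoc_subset_uIcc hu)))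
  refine ⟨C * |β - 0| + C * |β - 0|, fun T => ?_⟩
  have h := Complex.integral_boundary_rect_eq_zero_of_differentiableOn g 0 (T + β * Complex.I)
    hg.differentiableOn
  simp only [Complex.zero_re, Complex.zero_im, Complex.add_re, Complex.add_im, Complex.ofReal_re,
    Complex.ofReal_im, Complex.mul_re, Complex.mul_im, Complex.I_re, Complex.I_im, mul_zero,
    mul_one, sub_zero, add_zero, zero_add, zero_mul, smul_eq_mul, Complex.ofReal_zero] at h
  have h0 := hside 0
  have hT := hside T
  simp only [Complex.ofReal_zero, zero_add] at h0
  set a := ∫ t in (0 : ℝ)..T, g t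
  set b := ∫ t in (0 : ℝ)..T, g (t + β * Complex.I)
  set u := ∫ u in (0 : ℝ)..β, g (T + u * Complex.I)
  set v := ∫ u in (0 : ℝ)..β, g (u * Complex.I)
  have : a - b = Complex.I * v - Complex.I * u := by linear_combination h
  rw [this]
  refine (norm_sub_le _ _).trans ?_
  rw [norm_mul, norm_mul, Complex.norm_I, one_mul, one_mul]
  exact add_le_add h0 hT

theorem le_of_forall_mul_le_mul_add {a M K : ℝ} (h : ∀ T : ℝ, 0 < T → a * T ≤ M * T + K) :
    a ≤ M := by
  by_contra! hlt
  have hpos : 0 < a - M := sub_pos.2 hlt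
  have hT : 0 < (|K| + 1) / (a - M) := by positivity
  have := h _ hT
  have h2 : (a - M) * ((|K| + 1) / (a - M)) = |K| + 1 := mul_div_cancel₀ _ hpos.ne'
  nlinarith [le_abs_self K]

/-- The defect of the KMS condition at an eigenvector `y₀` of the flow is controlled by the
distance of `y₀` to the elements satisfying the condition. -/
theorem norm_kms_defect_le {ω : A →L[ℂ] ℂ} {β lam : ℝ} {x y y₀ : A} {f : ℂ → A}
    (hf : IsEntireExtension σ y f)
    (h : ∀ t : ℝ, ω (x * f (t + β * Complex.I)) = ω (σ (Multiplicative.ofAdd t) y * x))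
    (hy₀ : ∀ t : ℝ, σ (Multiplicative.ofAdd t) y₀ = Complex.exp (Complex.I * t * lam) • y₀) :
    ‖(Real.exp (-β * lam) : ℂ) * ω (x * y₀) - ω (y₀ * x)‖ ≤
      (Real.exp (-β * lam) + 1) * (‖ω‖ * (‖x‖ * ‖y - y₀‖)) := by
  set c : ℂ := (Real.exp (-β * lam) : ℂ) with hc
  have hcn : ‖c‖ = Real.exp (-β * lam) := by
    rw [hc, Complex.norm_real, Real.norm_eq_abs, abs_of_pos (Real.exp_pos _)]
  have hωmul : ∀ a b : A, ‖ω (a * b)‖ ≤ ‖ω‖ * (‖a‖ * ‖b‖) := fun a b =>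
    (ω.le_opNorm _).trans (mul_le_mul_of_nonneg_left (norm_mul_le _ _) (norm_nonneg _))
  -- The factor e^{-iλz} cancels the growth of an eigenvector: for y = y₀ this function would be
  -- constant.
  let g : ℂ → ℂ := fun z => Complex.exp (-(Complex.I * lam * z)) * ω (x * f z)
  have hg : Differentiable ℂ g := by
    refine Differentiable.mul (by fun_prop) ?_
    exact ω.differentiable.comp ((differentiable_const x).mul hf.differentiable)
  have hexp : ∀ T u : ℝ, ‖Complex.exp (-(Complex.I * lam * (T + u * Complex.I)))‖ =
      Real.exp (lam * u) := fun T u => by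
    rw [Complex.norm_exp]; congr 1; simp
  obtain ⟨K, hK⟩ := exists_norm_integral_sub_integral_le hg β
    (q := fun u => Real.exp (lam * u) * (‖ω‖ * (‖x‖ * ‖f (u * Complex.I)‖)))
    (by
      have := hf.differentiable.continuous
      fun_prop)
    (fun T u => by
      rw [norm_mul, hexp]
      refine mul_le_mul_of_nonneg_left ((hωmul _ _).trans ?_) (Real.exp_pos _).le
      -- Since f(iu + T) = σ_T(f(iu)) and σ_T is contractive, the bound on the vertical sides does
      -- not depend on T.
      rw [add_comm, hf.apply_add_ofReal]
      gcongr
      exact norm_flow_apply_le _ _)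
  set k := c * ω (x * y₀) - ω (y₀ * x) with hk
  have hpt : ∀ t : ℝ, c * (g t - g (t + β * Complex.I)) =
      Complex.exp (-(Complex.I * lam * t)) * (c * ω (x * σ (Multiplicative.ofAdd t) y) -
        ω (σ (Multiplicative.ofAdd t) y * x)) := fun t => by
    simp only [g]
    rw [h, hf.apply_ofReal]
    have : Complex.exp (-(Complex.I * lam * (t + β * Complex.I))) * c =
        Complex.exp (-(Complex.I * lam * t)) := by
      rw [hc, Complex.ofReal_exp, ← Complex.exp_add]
      congr 1
      push_cast
      linear_combination (-(lam : ℂ) * β) * Complex.I_mul_I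
    linear_combination (-ω (σ (Multiplicative.ofAdd t) y * x)) * this
  have hk' : ∀ t : ℝ, k =
      Complex.exp (-(Complex.I * lam * t)) * (c * ω (x * σ (Multiplicative.ofAdd t) y₀) -
        ω (σ (Multiplicative.ofAdd t) y₀ * x)) := fun t => by
    rw [hy₀, mul_smul_comm, smul_mul_assoc, map_smul, map_smul, smul_eq_mul, smul_eq_mul]
    have : Complex.exp (-(Complex.I * lam * t)) * Complex.exp (Complex.I * t * lam) = 1 := by
      rw [← Complex.exp_add, ← Complex.exp_zero]
      congr 1
      ring
    linear_combination (-k) * this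
  -- By `hk'` the defect k is the same expression with y₀ in place of y, for every t, so the
  -- difference is linear in y₀ - y.
  have hdiff : ∀ t : ℝ, ‖k - c * (g t - g (t + β * Complex.I))‖ ≤
      (Real.exp (-β * lam) + 1) * (‖ω‖ * (‖x‖ * ‖y - y₀‖)) := fun t => by
    have hst : ‖σ (Multiplicative.ofAdd t) (y₀ - y)‖ ≤ ‖y - y₀‖ := by
      rw [norm_sub_rev y]; exact norm_flow_apply_le _ _
    have e1 := hexp t 0
    simp only [Complex.ofReal_zero, zero_mul, add_zero, mul_zero, Real.exp_zero] at e1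
    have : k - c * (g t - g (t + β * Complex.I)) = Complex.exp (-(Complex.I * lam * t)) *
        (c * ω (x * σ (Multiplicative.ofAdd t) (y₀ - y)) -
          ω (σ (Multiplicative.ofAdd t) (y₀ - y) * x)) := by
      rw [hpt t, hk' t]
      simp only [map_sub, mul_sub, sub_mul]
      ring
    rw [this, norm_mul, e1, one_mul]
    refine (norm_sub_le _ _).trans ?_
    rw [norm_mul, hcn, add_mul, one_mul]
    gcongr
    · refine (hωmul _ _).trans ?_
      gcongr
    · refine (hωmul _ _).trans ?_
      rw [mul_comm ‖x‖]
      gcongr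
  -- Integrating over [0, T] multiplies k and its bound by T, while the contour shift contributes a
  -- constant.
  refine le_of_forall_mul_le_mul_add (K := Real.exp (-β * lam) * K) fun T hT => ?_
  have hgc := hg.continuous
  have hi1 : IntervalIntegrable (fun t : ℝ => g t) MeasureTheory.volume 0 T :=
    (by fun_prop : Continuous fun t : ℝ => g t).intervalIntegrable _ _
  have hi2 : IntervalIntegrable (fun t : ℝ => g (t + β * Complex.I)) MeasureTheory.volume 0 T :=
    (by fun_prop : Continuous fun t : ℝ => g (t + β * Complex.I)).intervalIntegrable _ _
  have hint : (∫ t in (0 : ℝ)..T, (k - c * (g t - g (t + β * Complex.I)))) =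
      T * k - c * ((∫ t in (0 : ℝ)..T, g t) - ∫ t in (0 : ℝ)..T, g (t + β * Complex.I)) := by
    rw [intervalIntegral.integral_sub (by simp) ((hi1.sub hi2).const_mul c),
      intervalIntegral.integral_const_mul, intervalIntegral.integral_sub hi1 hi2]
    simp
  have hb : ‖∫ t in (0 : ℝ)..T, (k - c * (g t - g (t + β * Complex.I)))‖ ≤
      (Real.exp (-β * lam) + 1) * (‖ω‖ * (‖x‖ * ‖y - y₀‖)) * |T - 0| :=
    intervalIntegral.norm_integral_le_of_norm_le_const fun t _ => hdiff t
  rw [hint, sub_zero, abs_of_pos hT] at hb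
  have hn := norm_sub_norm_le ((T : ℂ) * k)
    (c * ((∫ t in (0 : ℝ)..T, g t) - ∫ t in (0 : ℝ)..T, g (t + β * Complex.I)))
  rw [norm_mul, norm_mul, hcn, Complex.norm_real, Real.norm_eq_abs, abs_of_pos hT] at hn
  have := mul_le_mul_of_nonneg_left (hK T) (Real.exp_pos (-β * lam)).le
  linarith

/-- A KMS state satisfies the KMS condition at all eigenvectors of the flow. -/
theorem IsKMSState.apply_eigenvector_mul {ω : A →L[ℂ] ℂ} {β : ℝ} (hω : IsKMSState σ β ω)
    {lam : ℝ} {y₀ : A}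
    (hy₀ : ∀ t : ℝ, σ (Multiplicative.ofAdd t) y₀ = Complex.exp (Complex.I * t * lam) • y₀)
    (x : A) : ω (y₀ * x) = (Real.exp (-β * lam) : ℂ) * ω (x * y₀) := by
  obtain ⟨D, hD, hinv, hana, hkms⟩ := hω.exists_dense
  have key : ∀ x ∈ (D : Set A), ω (y₀ * x) = (Real.exp (-β * lam) : ℂ) * ω (x * y₀) := by
    intro x hx
    -- The inequality is a closed condition on y that holds on D, hence also at y = y₀, where its
    -- right side is 0.
    have hcl : IsClosed {y : A | ‖(Real.exp (-β * lam) : ℂ) * ω (x * y₀) - ω (y₀ * x)‖ ≤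
        (Real.exp (-β * lam) + 1) * (‖ω‖ * (‖x‖ * ‖y - y₀‖))} :=
      isClosed_le continuous_const (by fun_prop)
    have hmem := hcl.closure_subset_iff.2 (fun y (hy : y ∈ D) => by
      obtain ⟨f, hf⟩ := hana y hy
      refine norm_kms_defect_le hf (fun t => ?_) hy₀
      rw [← hkms x hx _ (hinv t y hy) _ (hf.translate t), add_comm, mul_comm Complex.I]) (hD y₀)
    simp only [Set.mem_ofPred_eq, sub_self, norm_zero, mul_zero] at hmem
    exact (sub_eq_zero.1 (norm_le_zero_iff.1 hmem)).symm
  exact congrFun (Continuous.ext_on hD (f := fun x => ω (y₀ * x))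
    (g := fun x => (Real.exp (-β * lam) : ℂ) * ω (x * y₀)) (by fun_prop) (by fun_prop) key) x

end EntireExtension

end Cuntz

namespace Cuntz

/-! ### A Cuntz family on `ℓ²(Y)` -/

section Shift

variable {d : ℕ} {Y : Type} [DecidableEq Y]

theorem orthonormal_single {ι : Type*} {v : ι → Y} (hv : Function.Injective v) :
    Orthonormal ℂ fun i => (lp.single 2 (v i) (1 : ℂ) : lp (fun _ : Y => ℂ) 2) := by
  refine ⟨fun i => ?_, fun i j hij => ?_⟩
  · rw [lp.norm_single (by norm_num)]
    simp
  · change inner ℂ _ _ = _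
    rw [lp.inner_single_left, lp.single_apply_ne _ _ _ (hv.ne hij)]
    simp

/-- The isometry `δ_y ↦ δ_{e(i, y)}` of `ℓ²(Y)`. -/
noncomputable def shiftIsometry (e : Fin d × Y ≃ Y) (i : Fin d) :
    lp (fun _ : Y => ℂ) 2 →L[ℂ] lp (fun _ : Y => ℂ) 2 :=
  (orthonormal_single (v := fun y : Y => e (i, y))
    (e.injective.comp (Prod.mk_right_injective
      i))).orthogonalFamily.linearIsometry.toContinuousLinearMap

theorem shiftIsometry_single (e : Fin d × Y ≃ Y) (i : Fin d) (y : Y) :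
    shiftIsometry e i (lp.single 2 y (1 : ℂ)) = lp.single 2 (e (i, y)) (1 : ℂ) := by
  refine (OrthogonalFamily.linearIsometry_apply_single
    (orthonormal_single (v := fun y : Y => e (i, y))
      (e.injective.comp (Prod.mk_right_injective i))).orthogonalFamily (1 : ℂ)).trans ?_
  simp

theorem star_shiftIsometry_apply (e : Fin d × Y ≃ Y) (i : Fin d)
    (f : lp (fun _ : Y => ℂ) 2) (y : Y) : (star (shiftIsometry e i) f) y = f (e (i, y)) := by
  have h := ContinuousLinearMap.adjoint_inner_right (shiftIsometry e i)
    (lp.single 2 y (1 : ℂ)) f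
  rw [shiftIsometry_single, lp.inner_single_left, lp.inner_single_left,
    ← ContinuousLinearMap.star_eq_adjoint] at h
  simpa using h

theorem shiftIsometry_apply (e : Fin d × Y ≃ Y) (i j : Fin d)
    (f : lp (fun _ : Y => ℂ) 2) (y : Y) :
    (shiftIsometry e i f) (e (j, y)) = if i = j then f y else 0 := by
  have h := ContinuousLinearMap.adjoint_inner_left (shiftIsometry e i) f
    (lp.single 2 (e (j, y)) (1 : ℂ))
  have h2 : (star (shiftIsometry e i)) (lp.single 2 (e (j, y)) (1 : ℂ)) =
      if i = j then lp.single 2 y (1 : ℂ) else 0 := by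
    refine lp.ext (funext fun z => ?_)
    rw [star_shiftIsometry_apply]
    split_ifs with hij
    · subst hij
      simp [Pi.single_apply]
    · simp [hij]
  rw [← ContinuousLinearMap.star_eq_adjoint, h2, lp.inner_single_left] at h
  split_ifs at h ⊢
  · rw [lp.inner_single_left] at h
    simpa using h.symm
  · simpa using h.symm

/-- Bijectivity of e partitions Y into d copies of itself: injectivity makes the ranges orthogonal,
surjectivity makes them fill ℓ²(Y). -/
theorem isCuntzFamily_shiftIsometry (e : Fin d × Y ≃ Y) : IsCuntzFamily (shiftIsometry e) where
  star_mul i j := by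
    refine ContinuousLinearMap.ext fun f => lp.ext (funext fun y => ?_)
    rw [mul_apply_eq_comp, star_shiftIsometry_apply, shiftIsometry_apply]
    simp only [eq_comm (a := j)]
    split_ifs <;> simp
  sum_mul_star := by
    refine ContinuousLinearMap.ext fun f => lp.ext (funext fun z => ?_)
    obtain ⟨⟨j, y⟩, rfl⟩ := e.surjective z
    rw [sum_apply, lp.coeFn_sum, Finset.sum_apply]
    simp only [mul_apply_eq_comp, shiftIsometry_apply, star_shiftIsometry_apply]
    simp

theorem nontrivial_clm_lp (y : Y) :
    Nontrivial (lp (fun _ : Y => ℂ) 2 →L[ℂ] lp (fun _ : Y => ℂ) 2) := by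
  have : Nontrivial (lp (fun _ : Y => ℂ) 2) := by
    refine ⟨lp.single 2 y 1, 0, fun h => ?_⟩
    have := congrArg (fun f : lp (fun _ : Y => ℂ) 2 => f y) h
    simp at this
  infer_instance

end Shift

/-! ### Vector states and a state graded by word length -/

open scoped ComplexOrder in
/-- A unit vector in a representation defines a state. -/
theorem exists_vectorState {A H : Type*} [CStarAlgebra A] [NormedAddCommGroup H]
    [InnerProductSpace ℂ H] [CompleteSpace H] (π : A →⋆ₐ[ℂ] (H →L[ℂ] H)) {ξ : H} (hξ : ‖ξ‖ = 1) :
    ∃ φ : A →L[ℂ] ℂ, IsState φ ∧ (∀ a, ‖φ a‖ ≤ ‖a‖) ∧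
      ∀ a b, φ (star a * b) = inner ℂ (π a ξ) (π b ξ) := by
  let φ₀ : A →ₗ[ℂ] ℂ :=
    { toFun := fun a => inner ℂ ξ (π a ξ)
      map_add' := fun a b => by simp
      map_smul' := fun c a => by simp }
  have hφ₀ : ∀ a, ‖φ₀ a‖ ≤ 1 * ‖a‖ := fun a => by
    have h1 : ‖φ₀ a‖ ≤ ‖ξ‖ * ‖π a ξ‖ := norm_inner_le_norm (𝕜 := ℂ) ξ (π a ξ)
    have h2 := (π a).le_opNorm ξ
    have h3 : ‖π a‖ ≤ ‖a‖ := NonUnitalStarAlgHom.norm_apply_le π a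
    rw [hξ] at h1 h2
    linarith
  have hφ : ∀ a b, φ₀ (star a * b) = inner ℂ (π a ξ) (π b ξ) := fun a b => by
    change inner ℂ ξ (π (star a * b) ξ) = _
    rw [map_mul, map_star, mul_apply_eq_comp, ContinuousLinearMap.star_eq_adjoint,
      ContinuousLinearMap.adjoint_inner_right]
  refine ⟨φ₀.mkContinuous 1 hφ₀, ⟨fun a => ?_, ?_⟩, fun a => (hφ₀ a).trans_eq (one_mul _), hφ⟩
  · rw [LinearMap.mkContinuous_apply, hφ, inner_self_eq_norm_sq_to_K]
    have h : (0 : ℂ) ≤ ((‖π a ξ‖ ^ 2 : ℝ) : ℂ) := Complex.zero_le_real.2 (sq_nonneg _)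
    rwa [Complex.ofReal_pow] at h
  · rw [LinearMap.mkContinuous_apply]
    change inner ℂ ξ (π 1 ξ) = _
    rw [map_one, one_apply_eq_self, inner_self_eq_norm_sq_to_K, hξ]
    simp

namespace CuntzAlgebra

variable {d : ℕ}

theorem word_nil : word ([] : List (Fin d)) = 1 := rfl

theorem word_cons (i : Fin d) (α : List (Fin d)) : word (i :: α) = s i * word α := by
  simp [word]

theorem word_append (α γ : List (Fin d)) : word (α ++ γ) = word α * word γ := by
  simp [word]

theorem star_s_mul_s (i j : Fin d) : star (s i) * s j = if i = j then 1 else 0 :=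
  isCuntzFamily_s.star_mul i j

/-- There is a contractive state of `𝒪_d` invariant under the gauge action. -/
theorem exists_graded_state (hd : 0 < d) : Nontrivial (CuntzAlgebra d) ∧
    ∃ φ : CuntzAlgebra d →L[ℂ] ℂ, IsState φ ∧ (∀ a, ‖φ a‖ ≤ ‖a‖) ∧
      ∀ α γ : List (Fin d), α.length ≠ γ.length → φ (word α * star (word γ)) = 0 := by
  classical
  have : Nonempty (Fin d) := ⟨⟨0, hd⟩⟩
  obtain ⟨hden⟩ := nonempty_denumerable (Fin d × ℕ)
  let g : Fin d × ℕ ≃ ℕ := Denumerable.eqv _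
  -- The ℤ-coordinate is a level raised by one by every generator; it must run over ℤ so that
  -- adjoints can lower it indefinitely.
  let e : Fin d × (ℕ × ℤ) ≃ ℕ × ℤ :=
    (Equiv.prodAssoc _ _ _).symm.trans (g.prodCongr (Equiv.addRight 1))
  have he : ∀ i n m, e (i, (n, m)) = (g (i, n), m + 1) := fun _ _ _ => rfl
  have hnt := nontrivial_clm_lp (Y := ℕ × ℤ) (0, 0)
  let ρ : CuntzRep d := ⟨_, shiftIsometry e, isCuntzFamily_shiftIsometry e⟩
  let π : CuntzAlgebra d →⋆ₐ[ℂ] (lp (fun _ : ℕ × ℤ => ℂ) 2 →L[ℂ] lp (fun _ : ℕ × ℤ => ℂ) 2) :=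
    eval ρ
  have hπ : ∀ i, π (s i) = shiftIsometry e i := fun _ => rfl
  let ξ : lp (fun _ : ℕ × ℤ => ℂ) 2 := lp.single 2 (0, 0) 1
  have hξ : ‖ξ‖ = 1 := by rw [lp.norm_single (by norm_num)]; simp
  obtain ⟨φ, hφs, hφn, hφ⟩ := exists_vectorState π hξ
  have hlevel : ∀ (γ : List (Fin d)) (m : ℤ) (f : lp (fun _ : ℕ × ℤ => ℂ) 2),
      (∀ n k, k ≠ m → f (n, k) = 0) →
      ∀ n k, k ≠ m - γ.length → (π (star (word γ)) f) (n, k) = 0 := by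
    intro γ
    induction γ with
    | nil =>
      intro m f hf n k hk
      rw [word_nil, star_one, map_one]
      exact hf n k (by simpa using hk)
    | cons i γ ih =>
      intro m f hf n k hk
      rw [word_cons, star_mul, map_mul, mul_apply_eq_comp]
      refine ih (m - 1) _ (fun n k hk => ?_) n k (fun h => hk ?_)
      · rw [map_star, hπ, star_shiftIsometry_apply, he]
        exact hf _ _ (by omega)
      · simp only [List.length_cons]
        push_cast
        omega
  refine ⟨π.toAlgHom.toRingHom.domain_nontrivial, φ, hφs, hφn, fun α γ hαγ => ?_⟩
  -- The value becomes ⟨s_α^* ξ, s_γ^* ξ⟩, whose two vectors live on levels -|α| and -|γ|.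
  conv_lhs => rw [← star_star (word α)]
  rw [hφ, lp.inner_eq_tsum]
  have hξ0 : ∀ n k, k ≠ (0 : ℤ) → ξ (n, k) = 0 := fun n k hk =>
    lp.single_apply_ne _ _ _ (by simp [hk])
  refine (tsum_congr fun z => ?_).trans tsum_zero
  obtain ⟨n, k⟩ := z
  by_cases hk : k = 0 - α.length
  · rw [hlevel γ 0 ξ hξ0 n k (by omega), inner_zero_right]
  · rw [hlevel α 0 ξ hξ0 n k hk, inner_zero_left]

end CuntzAlgebra
end Cuntz

namespace Cuntz

/-! ### Limits of states and the transfer operator -/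

section States

open scoped ComplexOrder

variable {A : Type*} [CStarAlgebra A]

/-- A sequence of contractive states has a weak-⋆ cluster point, which is again a state. -/
theorem exists_isState_of_eventually {φ : ℕ → A →L[ℂ] ℂ} (hφ : ∀ n, IsState (φ n))
    (hb : ∀ n a, ‖φ n a‖ ≤ ‖a‖) :
    ∃ ω : A →L[ℂ] ℂ, IsState ω ∧
      ∀ a c, (∀ᶠ n in Filter.atTop, φ n a = c) → ω a = c := by
  have hK := WeakDual.isCompact_closedBall (𝕜 := ℂ) (E := A) 0 1
  obtain ⟨ω, -, hω⟩ := hK.ultrafilter_le_nhds'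
    ((Filter.hyperfilter ℕ).map fun n => StrongDual.toWeakDual (φ n)) (by
      refine Ultrafilter.mem_map.2 (Filter.univ_mem' fun n => ?_)
      simp only [Set.mem_preimage, mem_closedBall_zero_iff]
      exact (φ n).opNorm_le_bound zero_le_one fun a => by simpa using hb n a)
  have hlim : ∀ a, Filter.Tendsto (fun n => φ n a) (Filter.hyperfilter ℕ : Filter ℕ)
      (nhds (ω a)) := fun a =>
    (((WeakDual.eval_continuous a).tendsto ω).mono_left hω).comp Filter.tendsto_map
  have hval : ∀ a c, (∀ᶠ n in Filter.atTop, φ n a = c) → ω a = c := fun a c h => by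
    refine tendsto_nhds_unique (hlim a) (tendsto_const_nhds.congr' ?_)
    have := Nat.hyperfilter_le_atTop h
    filter_upwards [this] with n hn using hn.symm
  refine ⟨WeakDual.toStrongDual ω, ⟨fun a => ?_, ?_⟩, hval⟩
  · exact ge_of_tendsto (hlim (star a * a)) (Filter.Eventually.of_forall fun n => (hφ n).nonneg a)
  · exact hval 1 1 (Filter.Eventually.of_forall fun n => (hφ n).map_one)

variable {d : ℕ}

/-- The functional `a ↦ ∑ i, p i * φ (S i^* a S i)`. -/
noncomputable def transfer (S : Fin d → A) (p : Fin d → ℝ) (φ : A →L[ℂ] ℂ) : A →L[ℂ] ℂ :=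
  ∑ i, (p i : ℂ) • φ.comp ((ContinuousLinearMap.mul ℂ A (star (S i))).comp
    ((ContinuousLinearMap.mul ℂ A).flip (S i)))

theorem transfer_apply (S : Fin d → A) (p : Fin d → ℝ) (φ : A →L[ℂ] ℂ) (a : A) :
    transfer S p φ a = ∑ i, (p i : ℂ) * φ (star (S i) * (a * S i)) := by
  simp [transfer, sum_apply]

theorem IsState.transfer {S : Fin d → A} (hS : IsCuntzFamily S) {p : Fin d → ℝ}
    (hp : ∀ i, 0 ≤ p i) (hp1 : ∑ i, p i = 1) {φ : A →L[ℂ] ℂ} (hφ : IsState φ) :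
    IsState (transfer S p φ) where
  nonneg a := by
    rw [transfer_apply]
    refine Finset.sum_nonneg fun i _ => mul_nonneg (by exact_mod_cast hp i) ?_
    have := hφ.nonneg (a * S i)
    rwa [star_mul, mul_assoc, ← mul_assoc (star a)] at this
  map_one := by
    rw [transfer_apply]
    simp only [one_mul, hS.star_mul, if_true, hφ.map_one, mul_one]
    exact_mod_cast hp1

theorem norm_transfer_apply_le [Nontrivial A] {S : Fin d → A} (hS : IsCuntzFamily S)
    {p : Fin d → ℝ} (hp : ∀ i, 0 ≤ p i) (hp1 : ∑ i, p i = 1) {φ : A →L[ℂ] ℂ}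
    (hφ : ∀ a, ‖φ a‖ ≤ ‖a‖) (a : A) : ‖transfer S p φ a‖ ≤ ‖a‖ := by
  rw [transfer_apply]
  refine (norm_sum_le _ _).trans ?_
  calc ∑ i, ‖(p i : ℂ) * φ (star (S i) * (a * S i))‖ ≤ ∑ i, p i * ‖a‖ := by
        refine Finset.sum_le_sum fun i _ => ?_
        rw [norm_mul, Complex.norm_real, Real.norm_of_nonneg (hp i)]
        refine mul_le_mul_of_nonneg_left ((hφ _).trans ?_) (hp i)
        have h1 := hS.norm_le_one i
        calc ‖star (S i) * (a * S i)‖ ≤ ‖star (S i)‖ * (‖a‖ * ‖S i‖) :=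
              (norm_mul_le _ _).trans
                (mul_le_mul_of_nonneg_left (norm_mul_le _ _) (norm_nonneg _))
          _ ≤ 1 * (‖a‖ * 1) := by
              rw [norm_star]
              gcongr
          _ = ‖a‖ := by ring
    _ = ‖a‖ := by rw [← Finset.sum_mul, hp1, one_mul]

end States

namespace CuntzAlgebra

variable {d : ℕ}

/-! ### Values of functionals on words -/

theorem transfer_cons_cons (p : Fin d → ℝ) (φ : CuntzAlgebra d →L[ℂ] ℂ) (i j : Fin d)
    (α γ : List (Fin d)) :
    transfer s p φ (word (i :: α) * star (word (j :: γ))) =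
      if i = j then (p i : ℂ) * φ (word α * star (word γ)) else 0 := by
  rw [transfer_apply, Finset.sum_eq_single i]
  · have : star (s i) * (word (i :: α) * star (word (j :: γ)) * s i) =
        (star (s i) * s i) * (word α * star (word γ)) * (star (s j) * s i) := by
      simp only [word_cons, star_mul, mul_assoc]
    rw [this, star_s_mul_s, star_s_mul_s]
    by_cases h : i = j
    · simp [h]
    · simp [h, Ne.symm h]
  · intro k _ hk
    have : star (s k) * (word (i :: α) * star (word (j :: γ)) * s k) =
        (star (s k) * s i) * (word α * star (word (j :: γ)) * s k) := by
      simp only [word_cons, mul_assoc]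
    rw [this, star_s_mul_s, if_neg hk, zero_mul, map_zero, mul_zero]
  · simp

/-- Against an empty word the other one is rotated, not shortened. Iteration alone therefore does
not kill such values; they must vanish at the start. -/
theorem transfer_nil_cons (p : Fin d → ℝ) (φ : CuntzAlgebra d →L[ℂ] ℂ) (j : Fin d)
    (γ : List (Fin d)) :
    transfer s p φ (word [] * star (word (j :: γ))) =
      (p j : ℂ) * φ (word [] * star (word (γ ++ [j]))) := by
  rw [transfer_apply, Finset.sum_eq_single j]
  · have : star (s j) * (word [] * star (word (j :: γ)) * s j) =
        star (s j) * star (word γ) * (star (s j) * s j) := by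
      simp only [word_cons, word_nil, star_mul, mul_assoc, one_mul]
    rw [this, star_s_mul_s, if_pos rfl, mul_one, ← star_mul, word_append, word_cons, word_nil,
      one_mul, mul_one]
  · intro k _ hk
    have : star (s k) * (word [] * star (word (j :: γ)) * s k) =
        star (s k) * star (word γ) * (star (s j) * s k) := by
      simp only [word_cons, word_nil, star_mul, mul_assoc, one_mul]
    rw [this, star_s_mul_s, if_neg (Ne.symm hk), mul_zero, map_zero, mul_zero]
  · simp

theorem transfer_cons_nil (p : Fin d → ℝ) (φ : CuntzAlgebra d →L[ℂ] ℂ) (i : Fin d)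
    (α : List (Fin d)) :
    transfer s p φ (word (i :: α) * star (word [])) =
      (p i : ℂ) * φ (word (α ++ [i]) * star (word [])) := by
  rw [transfer_apply, Finset.sum_eq_single i]
  · have : star (s i) * (word (i :: α) * star (word []) * s i) =
        (star (s i) * s i) * (word α * s i) := by
      simp only [word_cons, word_nil, star_one, mul_assoc, one_mul]
    rw [this, star_s_mul_s, if_pos rfl, one_mul, word_append, word_cons, word_nil, star_one,
      mul_one, mul_one]
  · intro k _ hk
    have : star (s k) * (word (i :: α) * star (word []) * s k) =
        (star (s k) * s i) * (word α * s k) := by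
      simp only [word_cons, word_nil, star_one, mul_assoc, one_mul]
    rw [this, star_s_mul_s, if_neg hk, zero_mul, map_zero, mul_zero]
  · simp

/-- The quasi-free state of `𝒪_d` with weights `p`. -/
theorem exists_state_of_weights (hd : 0 < d) {p : Fin d → ℝ} (hp : ∀ i, 0 ≤ p i)
    (hp1 : ∑ i, p i = 1) :
    ∃ ω : CuntzAlgebra d →L[ℂ] ℂ, IsState ω ∧ ∀ α γ : List (Fin d),
      ω (word α * star (word γ)) = if α = γ then (((α.map p).prod : ℝ) : ℂ) else 0 := by
  obtain ⟨hnt, φ₀, hφ₀, hn, hgr⟩ := exists_graded_state hd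
  let φ : ℕ → CuntzAlgebra d →L[ℂ] ℂ := fun n => (transfer s p)^[n] φ₀
  have hsucc : ∀ n, φ (n + 1) = transfer s p (φ n) := fun n =>
    Function.iterate_succ_apply' _ _ _
  have hst : ∀ n, IsState (φ n) := fun n => by
    induction n with
    | zero => exact hφ₀
    | succ n ih => rw [hsucc]; exact ih.transfer isCuntzFamily_s hp hp1
  have hnorm : ∀ n a, ‖φ n a‖ ≤ ‖a‖ := fun n => by
    induction n with
    | zero => exact hn
    | succ n ih => rw [hsucc]; exact norm_transfer_apply_le isCuntzFamily_s hp hp1 ih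
  have hgrade : ∀ n (α γ : List (Fin d)), α.length ≠ γ.length →
      φ n (word α * star (word γ)) = 0 := fun n => by
    induction n with
    | zero => exact hgr
    | succ n ih =>
      intro α γ hαγ
      rw [hsucc]
      match α, γ with
      | [], [] => exact absurd rfl hαγ
      | [], j :: γ => rw [transfer_nil_cons, ih _ _ (by simp), mul_zero]
      | i :: α, [] => rw [transfer_cons_nil, ih _ _ (by simp), mul_zero]
      | i :: α, j :: γ =>
        rw [transfer_cons_cons, ih α γ (by simpa using hαγ), mul_zero, ite_self]
  have hword : ∀ n (α γ : List (Fin d)), α.length ≤ n →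
      φ n (word α * star (word γ)) = if α = γ then (((α.map p).prod : ℝ) : ℂ) else 0 := fun n => by
    induction n with
    | zero =>
      intro α γ hα
      obtain rfl : α = [] := by simpa using hα
      rcases γ with _ | ⟨j, γ⟩
      · simpa [word_nil] using (hst 0).map_one
      · rw [hgrade _ _ _ (by simp), if_neg (by simp)]
    | succ n ih =>
      intro α γ hα
      match α, γ with
      | [], [] => simpa [word_nil] using (hst (n + 1)).map_one
      | [], j :: γ => rw [hgrade _ _ _ (by simp), if_neg (by simp)]
      | i :: α, [] => rw [hgrade _ _ _ (by simp), if_neg (by simp)]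
      | i :: α, j :: γ =>
        rw [hsucc, transfer_cons_cons, ih α γ (by simpa using hα)]
        by_cases hij : i = j <;> by_cases hαγ : α = γ <;> simp [hij, hαγ]
  obtain ⟨ω, hω, hval⟩ := exists_isState_of_eventually hst hnorm
  refine ⟨ω, hω, fun α γ => hval _ _ ?_⟩
  filter_upwards [Filter.eventually_ge_atTop α.length] with n hle using hword n α γ hle

/-! ### Density of the span of the words -/

/-- The span is stable under left multiplication by each s_i and s_i^*, hence by the ⋆-algebra they
generate, and it contains 1. -/
theorem dense_span_words : Dense (Submodule.span ℂ
    (Set.range fun q : List (Fin d) × List (Fin d) => word q.1 * star (word q.2)) :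
      Set (CuntzAlgebra d)) := by
  set W := Submodule.span ℂ
    (Set.range fun q : List (Fin d) × List (Fin d) => word q.1 * star (word q.2))
  have hmem : ∀ α γ : List (Fin d), word α * star (word γ) ∈ W := fun α γ =>
    Submodule.subset_span ⟨(α, γ), rfl⟩
  have hgen : ∀ y : CuntzAlgebra d, (∀ α γ : List (Fin d), y * (word α * star (word γ)) ∈ W) →
      ∀ w ∈ W, y * w ∈ W := by
    intro y hy w hw
    have : W ≤ W.comap (LinearMap.mulLeft ℂ y) :=
      Submodule.span_le.2 (by rintro _ ⟨q, rfl⟩; exact hy q.1 q.2)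
    exact this hw
  have hs : ∀ i, ∀ w ∈ W, s i * w ∈ W := fun i => hgen _ fun α γ => by
    rw [← mul_assoc, ← word_cons]
    exact hmem _ _
  have hs' : ∀ i, ∀ w ∈ W, star (s i) * w ∈ W := fun i => hgen _ fun α γ => by
    rcases α with _ | ⟨j, α⟩
    · have := hmem [] (γ ++ [i])
      rw [word_append, star_mul, word_cons, word_nil, mul_one, one_mul] at this
      rwa [word_nil, one_mul]
    · rw [word_cons, mul_assoc, ← mul_assoc (star (s i)), star_s_mul_s]
      split_ifs
      · rw [one_mul]; exact hmem _ _
      · rw [zero_mul]; exact W.zero_mem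
  refine dense_adjoin_s.mono fun y hy => ?_
  have key : ∀ w ∈ W, y * w ∈ W := by
    change y ∈ Algebra.adjoin ℂ (Set.range s ∪ star (Set.range s)) at hy
    induction hy using Algebra.adjoin_induction with
    | mem x hx =>
      rcases hx with ⟨i, rfl⟩ | ⟨i, hi⟩
      · exact hs i
      · rw [← star_star x, ← hi]; exact hs' i
    | algebraMap r => intro w hw; rw [← Algebra.smul_def]; exact W.smul_mem r hw
    | add x y _ _ hx hy => intro w hw; rw [add_mul]; exact W.add_mem (hx w hw) (hy w hw)
    | mul x y _ _ hx hy => intro w hw; rw [mul_assoc]; exact hx _ (hy w hw)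
  have h1 : (1 : CuntzAlgebra d) ∈ W := by simpa [word_nil] using hmem [] []
  simpa using key 1 h1

/-- Continuous linear functionals that agree on the words are equal. -/
theorem eq_of_eq_on_words {f g : CuntzAlgebra d →ₗ[ℂ] ℂ} (hf : Continuous f) (hg : Continuous g)
    (h : ∀ α γ : List (Fin d), f (word α * star (word γ)) = g (word α * star (word γ))) :
    f = g := by
  refine DFunLike.ext' (Continuous.ext_on dense_span_words hf hg ?_)
  exact LinearMap.eqOn_span (by rintro _ ⟨q, rfl⟩; exact h q.1 q.2)

end CuntzAlgebra
end Cuntz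

namespace Cuntz

namespace CuntzAlgebra

variable {d : ℕ}

/-! ### Eigenvectors of the flow -/

theorem flow_word (L : Fin d → ℝ) (t : ℝ) (α : List (Fin d)) :
    flow L (Multiplicative.ofAdd t) (word α) =
      Complex.exp (Complex.I * t * ((α.map L).sum : ℝ)) • word α := by
  induction α with
  | nil => simp [word_nil]
  | cons i α ih =>
    rw [word_cons, map_mul, ih, flow_s, smul_mul_smul_comm, ← Complex.exp_add, ← word_cons]
    congr 2
    simp only [List.map_cons, List.sum_cons]
    push_cast
    ring

theorem star_exp_I_mul (t l : ℝ) :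
    star (Complex.exp (Complex.I * t * l)) = Complex.exp (Complex.I * t * ((-l : ℝ) : ℂ)) := by
  rw [Complex.star_def, ← Complex.exp_conj]
  congr 1
  simp

theorem flow_star_word (L : Fin d → ℝ) (t : ℝ) (α : List (Fin d)) :
    flow L (Multiplicative.ofAdd t) (star (word α)) =
      Complex.exp (Complex.I * t * ((-(α.map L).sum : ℝ) : ℂ)) • star (word α) := by
  rw [map_star, flow_word, star_smul, star_exp_I_mul]

theorem flow_star_s (L : Fin d → ℝ) (t : ℝ) (i : Fin d) :
    flow L (Multiplicative.ofAdd t) (star (s i)) =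
      Complex.exp (Complex.I * t * ((-L i : ℝ) : ℂ)) • star (s i) := by
  rw [map_star, flow_s, star_smul, star_exp_I_mul]

/-! ### Values of KMS states -/

section Values

variable {L : Fin d → ℝ} {β : ℝ} {ω : CuntzAlgebra d →L[ℂ] ℂ}

theorem sum_exp_eq_one_of_isKMSState (hω : IsKMSState (flow L) β ω) :
    ∑ k, Real.exp (-β * L k) = 1 := by
  have h : ∀ k, ω (s k * star (s k)) = (Real.exp (-β * L k) : ℂ) := fun k => by
    rw [hω.apply_eigenvector_mul (fun t => flow_s L t k), star_s_mul_s, if_pos rfl,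
      hω.isState.map_one, mul_one]
  have h1 := hω.isState.map_one
  rw [← isCuntzFamily_s.sum_mul_star, map_sum] at h1
  simp only [h] at h1
  exact_mod_cast h1

/-- A second positive summand exists because d ≥ 2, which forces e^{-βL_i} < 1. -/
theorem mul_pos_of_sum_exp_eq_one (hd : 2 ≤ d) (h : ∑ k, Real.exp (-β * L k) = 1) (i : Fin d) :
    0 < β * L i := by
  have : Nontrivial (Fin d) := Fin.nontrivial_iff_two_le.2 hd
  obtain ⟨j, hj⟩ := exists_ne i
  have hlt : Real.exp (-β * L i) < ∑ k, Real.exp (-β * L k) :=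
    Finset.single_lt_sum (f := fun k => Real.exp (-β * L k)) hj (Finset.mem_univ i)
      (Finset.mem_univ j) (Real.exp_pos _) fun _ _ _ => (Real.exp_pos _).le
  rw [h, Real.exp_lt_one_iff] at hlt
  linarith

theorem mul_sum_map_pos (h : ∀ i, 0 < β * L i) {α : List (Fin d)} (hα : α ≠ []) :
    0 < β * (α.map L).sum := by
  rw [← List.sum_map_mul_left]
  refine List.sum_pos _ (fun x hx => ?_) (by simpa using hα)
  obtain ⟨i, -, rfl⟩ := List.mem_map.1 hx
  exact h i

/-- A KMS state vanishes on eigenvectors with nontrivial eigenvalue. -/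
theorem apply_eq_zero_of_eigenvector (hω : IsKMSState (flow L) β ω) {lam : ℝ}
    {y : CuntzAlgebra d}
    (hy : ∀ t : ℝ, flow L (Multiplicative.ofAdd t) y = Complex.exp (Complex.I * t * lam) • y)
    (hlam : β * lam ≠ 0) : ω y = 0 := by
  have h := hω.apply_eigenvector_mul hy 1
  rw [mul_one, one_mul] at h
  have hne : (Real.exp (-β * lam) : ℂ) ≠ 1 := by
    rw [← Complex.ofReal_one, Ne, Complex.ofReal_inj, Real.exp_eq_one_iff]
    simpa using hlam
  have : (1 - (Real.exp (-β * lam) : ℂ)) * ω y = 0 := by linear_combination h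
  exact (mul_eq_zero.1 this).resolve_left (sub_ne_zero.2 hne.symm)

/-- Equal leading letters cancel and different ones give 0, until one word is exhausted. -/
theorem apply_star_word_mul_word (h1 : ω 1 = 1) (hw : ∀ α : List (Fin d), α ≠ [] → ω (word α) = 0)
    (hw' : ∀ α : List (Fin d), α ≠ [] → ω (star (word α)) = 0) (α γ : List (Fin d)) :
    ω (star (word γ) * word α) = if α = γ then 1 else 0 := by
  induction γ generalizing α with
  | nil =>
    rw [word_nil, star_one, one_mul]
    split_ifs with h
    · rw [h, word_nil, h1]
    · exact hw α h
  | cons j γ ih =>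
    rcases α with _ | ⟨i, α⟩
    · rw [word_nil, mul_one, hw' _ (by simp), if_neg (by simp)]
    · have : star (word (j :: γ)) * word (i :: α) =
          star (word γ) * (star (s j) * s i) * word α := by
        simp only [word_cons, star_mul, mul_assoc]
      rw [this, star_s_mul_s]
      by_cases hij : j = i
      · rw [if_pos hij, mul_one, ih]
        simp [hij]
      · simp [hij, Ne.symm hij]

theorem isKMSState_apply_words (hω : IsKMSState (flow L) β ω) (hL : ∀ i, 0 < β * L i)
    (α γ : List (Fin d)) :
    ω (word α * star (word γ)) =
      if α = γ then ((Real.exp (-β * (α.map L).sum) : ℝ) : ℂ) else 0 := by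
  rw [hω.apply_eigenvector_mul (fun t => flow_word L t α),
    apply_star_word_mul_word hω.isState.map_one
      (fun δ hδ => apply_eq_zero_of_eigenvector hω (fun t => flow_word L t δ)
        (mul_sum_map_pos hL hδ).ne')
      (fun δ hδ => apply_eq_zero_of_eigenvector hω (fun t => flow_star_word L t δ)
        (by rw [mul_neg]; exact neg_ne_zero.2 (mul_sum_map_pos hL hδ).ne'))]
  split_ifs <;> simp

/-! ### The KMS condition from the values on words -/

theorem isEntireExtension_eigenvector
    {σ : Multiplicative ℝ →* (CuntzAlgebra d ≃⋆ₐ[ℂ] CuntzAlgebra d)}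
    {y : CuntzAlgebra d} {lam : ℝ}
    (hy : ∀ t : ℝ, σ (Multiplicative.ofAdd t) y = Complex.exp (Complex.I * t * lam) • y) :
    IsEntireExtension σ y fun z => Complex.exp (Complex.I * z * lam) • y where
  differentiable := by
    have : Differentiable ℂ fun z : ℂ => Complex.exp (Complex.I * z * lam) := by fun_prop
    exact this.smul_const y
  apply_ofReal t := (hy t).symm

theorem exp_I_mul_I_mul (β l : ℝ) :
    Complex.exp (Complex.I * (Complex.I * β) * l) = (Real.exp (-β * l) : ℂ) := by
  rw [Complex.ofReal_exp]
  congr 1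
  push_cast
  linear_combination ((β : ℂ) * l) * Complex.I_mul_I

/-- By density it suffices to take x = s_μ s_ν^*. If ν is empty, both sides vanish; otherwise s_i
cancels against the first letter of ν, and the weight e^{-βL_i} supplies the letter missing from μ.
-/
theorem apply_s_mul (hv : ∀ α γ : List (Fin d), ω (word α * star (word γ)) =
      if α = γ then ((Real.exp (-β * (α.map L).sum) : ℝ) : ℂ) else 0) (i : Fin d)
    (x : CuntzAlgebra d) : ω (x * ((Real.exp (-β * L i) : ℂ) • s i)) = ω (s i * x) := by
  have hc : Continuous ω := ω.continuous
  refine DFunLike.congr_fun (eq_of_eq_on_words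
    (f := (ω : CuntzAlgebra d →ₗ[ℂ] ℂ) ∘ₗ
      LinearMap.mulRight ℂ ((Real.exp (-β * L i) : ℂ) • s i))
    (g := (ω : CuntzAlgebra d →ₗ[ℂ] ℂ) ∘ₗ LinearMap.mulLeft ℂ (s i))
    (hc.comp (continuous_mul_const _)) (hc.comp (continuous_const_mul _)) fun μ ν => ?_) x
  change ω (word μ * star (word ν) * ((Real.exp (-β * L i) : ℂ) • s i)) =
    ω (s i * (word μ * star (word ν)))
  rw [mul_smul_comm, map_smul, smul_eq_mul, ← mul_assoc (s i), ← word_cons, hv]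
  rcases ν with _ | ⟨j, ν⟩
  · have : word μ * star (word []) * s i = word (μ ++ [i]) * star (word []) := by
      simp [word_append, word_cons, word_nil]
    rw [this, hv]
    simp
  · have : word μ * star (word (j :: ν)) * s i = word μ * star (word ν) * (star (s j) * s i) := by
      simp only [word_cons, star_mul, mul_assoc]
    rw [this, star_s_mul_s]
    by_cases hij : j = i
    · subst hij
      rw [if_pos rfl, mul_one, hv]
      by_cases hμ : μ = ν
      · rw [if_pos hμ, if_pos (by rw [hμ]), ← Complex.ofReal_mul, ← Real.exp_add]
        congr 2
        simp only [List.map_cons, List.sum_cons]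
        ring
      · rw [if_neg hμ, if_neg (by simpa using hμ), mul_zero]
    · simp [hij, Ne.symm hij]

theorem apply_star_s_mul (hv : ∀ α γ : List (Fin d), ω (word α * star (word γ)) =
      if α = γ then ((Real.exp (-β * (α.map L).sum) : ℝ) : ℂ) else 0) (i : Fin d)
    (x : CuntzAlgebra d) :
    ω (x * ((Real.exp (-β * -L i) : ℂ) • star (s i))) = ω (star (s i) * x) := by
  have hc : Continuous ω := ω.continuous
  refine DFunLike.congr_fun (eq_of_eq_on_words
    (f := (ω : CuntzAlgebra d →ₗ[ℂ] ℂ) ∘ₗ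
      LinearMap.mulRight ℂ ((Real.exp (-β * -L i) : ℂ) • star (s i)))
    (g := (ω : CuntzAlgebra d →ₗ[ℂ] ℂ) ∘ₗ LinearMap.mulLeft ℂ (star (s i)))
    (hc.comp (continuous_mul_const _)) (hc.comp (continuous_const_mul _)) fun μ ν => ?_) x
  change ω (word μ * star (word ν) * ((Real.exp (-β * -L i) : ℂ) • star (s i))) =
    ω (star (s i) * (word μ * star (word ν)))
  rw [mul_smul_comm, map_smul, smul_eq_mul, mul_assoc, ← star_mul, ← word_cons, hv]
  rcases μ with _ | ⟨j, μ⟩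
  · have : star (s i) * (word [] * star (word ν)) = word [] * star (word (ν ++ [i])) := by
      simp [word_append, word_cons, word_nil]
    rw [this, hv]
    simp
  · have : star (s i) * (word (j :: μ) * star (word ν)) =
        (star (s i) * s j) * (word μ * star (word ν)) := by
      simp only [word_cons, mul_assoc]
    rw [this, star_s_mul_s]
    by_cases hij : i = j
    · subst hij
      rw [if_pos rfl, one_mul, hv]
      by_cases hμ : μ = ν
      · rw [if_pos hμ, if_pos (by rw [hμ]), ← Complex.ofReal_mul, ← Real.exp_add]
        congr 2
        simp only [List.map_cons, List.sum_cons]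
        ring
      · rw [if_neg hμ, if_neg (by simpa using hμ), mul_zero]
    · simp [hij, Ne.symm hij]

theorem flow_mem_adjoin (L : Fin d → ℝ) (t : ℝ) {y : CuntzAlgebra d}
    (hy : y ∈ StarAlgebra.adjoin ℂ (Set.range (s (d := d)))) :
    flow L (Multiplicative.ofAdd t) y ∈ StarAlgebra.adjoin ℂ (Set.range (s (d := d))) := by
  induction hy using StarAlgebra.adjoin_induction with
  | mem x hx =>
    obtain ⟨i, rfl⟩ := hx
    rw [flow_s]
    exact SMulMemClass.smul_mem _ (StarAlgebra.subset_adjoin ℂ _ (Set.mem_range_self i))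
  | algebraMap r =>
    rw [Algebra.algebraMap_eq_smul_one, map_smul, map_one]
    exact SMulMemClass.smul_mem _ (one_mem _)
  | add x y _ _ hx hy => rw [map_add]; exact add_mem hx hy
  | mul x y _ _ hx hy => rw [map_mul]; exact mul_mem hx hy
  | star x _ hx => rw [map_star]; exact star_mem hx

theorem exists_isEntireExtension_kms (hv : ∀ α γ : List (Fin d), ω (word α * star (word γ)) =
      if α = γ then ((Real.exp (-β * (α.map L).sum) : ℝ) : ℂ) else 0) {y : CuntzAlgebra d}
    (hy : y ∈ StarAlgebra.adjoin ℂ (Set.range (s (d := d)))) :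
    ∃ f : ℂ → CuntzAlgebra d, IsEntireExtension (flow L) y f ∧
      ∀ x, ω (x * f (Complex.I * β)) = ω (y * x) := by
  change y ∈ Algebra.adjoin ℂ (Set.range s ∪ star (Set.range s)) at hy
  induction hy using Algebra.adjoin_induction with
  | mem x hx =>
    rcases hx with ⟨i, rfl⟩ | ⟨i, hi⟩
    · refine ⟨_, isEntireExtension_eigenvector fun t => flow_s L t i, fun x => ?_⟩
      rw [exp_I_mul_I_mul]
      exact apply_s_mul hv i x
    · rw [← star_star x, ← hi]
      refine ⟨_, isEntireExtension_eigenvector fun t => flow_star_s L t i, fun x => ?_⟩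
      rw [exp_I_mul_I_mul]
      exact apply_star_s_mul hv i x
  | algebraMap r =>
    refine ⟨fun _ => algebraMap ℂ _ r, ⟨differentiable_const _, fun t => ?_⟩, fun x => ?_⟩
    · rw [Algebra.algebraMap_eq_smul_one, map_smul, map_one]
    · rw [Algebra.commutes]
  | add x y _ _ hx hy =>
    obtain ⟨f, hf, hfω⟩ := hx
    obtain ⟨g, hg, hgω⟩ := hy
    refine ⟨fun z => f z + g z, ⟨hf.differentiable.add hg.differentiable, fun t => ?_⟩,
      fun w => ?_⟩
    · rw [map_add, hf.apply_ofReal, hg.apply_ofReal]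
    · rw [mul_add, add_mul, map_add, map_add, hfω, hgω]
  | mul x y _ _ hx hy =>
    obtain ⟨f, hf, hfω⟩ := hx
    obtain ⟨g, hg, hgω⟩ := hy
    -- The KMS identity is multiplicative because it holds against all test elements: first g is
    -- moved past w f, then f past y w.
    refine ⟨fun z => f z * g z, ⟨hf.differentiable.mul hg.differentiable, fun t => ?_⟩,
      fun w => ?_⟩
    · rw [map_mul, hf.apply_ofReal, hg.apply_ofReal]
    · rw [← mul_assoc, hgω, ← mul_assoc, hfω, mul_assoc]

/-- A state with the values `δ_{αγ} e^{-β L_α}` on the words is a KMS state. -/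
theorem isKMSState_of_apply_words (hω : IsState ω)
    (hv : ∀ α γ : List (Fin d), ω (word α * star (word γ)) =
      if α = γ then ((Real.exp (-β * (α.map L).sum) : ℝ) : ℂ) else 0) :
    IsKMSState (flow L) β ω where
  isState := hω
  exists_dense := by
    refine ⟨(StarAlgebra.adjoin ℂ (Set.range (s (d := d)))).toNonUnitalStarSubalgebra,
      dense_adjoin_s, fun t y hy => flow_mem_adjoin L t hy, fun y hy => ?_,
      fun x _ y hy f hf => ?_⟩
    · obtain ⟨f, hf, -⟩ := exists_isEntireExtension_kms hv hy
      exact ⟨f, hf⟩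
    · obtain ⟨g, hg, hgω⟩ := exists_isEntireExtension_kms hv hy
      rw [hf.eq hg]
      exact hgω x

theorem prod_map_exp (L : Fin d → ℝ) (β : ℝ) (α : List (Fin d)) :
    (α.map fun i => Real.exp (-β * L i)).prod = Real.exp (-β * (α.map L).sum) := by
  induction α with
  | nil => simp
  | cons i α ih =>
    rw [List.map_cons, List.prod_cons, ih, ← Real.exp_add, List.map_cons, List.sum_cons, mul_add]

theorem exists_isKMSState (hd : 0 < d) (h : ∑ k, Real.exp (-β * L k) = 1) :
    ∃ ω : CuntzAlgebra d →L[ℂ] ℂ, IsKMSState (flow L) β ω := by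
  obtain ⟨ω, hω, hv⟩ := exists_state_of_weights hd (fun i => (Real.exp_pos (-β * L i)).le) h
  simp only [prod_map_exp] at hv
  exact ⟨ω, isKMSState_of_apply_words hω hv⟩

end Values

/-! ### The equation for the inverse temperature -/

/-- The sum is continuous and strictly decreasing in β, equals d at β = 0 and tends to 0 at
infinity. -/
theorem exists_sum_exp_eq_one_of_pos (hd : 2 ≤ d) {L : Fin d → ℝ} (hL : ∀ i, 0 < L i) :
    ∃ β : ℝ, ∀ β' : ℝ, ∑ k, Real.exp (-β' * L k) = 1 ↔ β' = β := by
  have : Nonempty (Fin d) := ⟨⟨0, by omega⟩⟩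
  let F : ℝ → ℝ := fun b => ∑ k, Real.exp (-b * L k)
  have hanti : StrictAnti F := fun b b' hb =>
    Finset.sum_lt_sum_of_nonempty Finset.univ_nonempty fun k _ =>
      Real.exp_lt_exp.2 (by nlinarith [hL k])
  have hcont : Continuous F := by fun_prop
  have hlim : Filter.Tendsto F Filter.atTop (nhds 0) := by
    rw [← Finset.sum_const_zero (ι := Fin d) (s := Finset.univ)]
    refine tendsto_finsetSum _ fun k _ => ?_
    have : Filter.Tendsto (fun b : ℝ => b * L k) Filter.atTop Filter.atTop :=
      Filter.tendsto_id.atTop_mul_const (hL k)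
    simpa [Function.comp_def] using Real.tendsto_exp_neg_atTop_nhds_zero.comp this
  obtain ⟨b, hb0, hb⟩ : ∃ b : ℝ, 0 ≤ b ∧ F b < 1 :=
    ((Filter.eventually_ge_atTop 0).and (hlim.eventually_lt_const one_pos)).exists
  have h0 : 1 ≤ F 0 := by
    simp only [F, neg_zero, zero_mul, Real.exp_zero, Finset.sum_const, Finset.card_univ,
      Fintype.card_fin, nsmul_eq_mul, mul_one]
    exact_mod_cast (by omega : 1 ≤ d)
  obtain ⟨β, -, hβ⟩ := intermediate_value_Icc' hb0 hcont.continuousOn ⟨hb.le, h0⟩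
  exact ⟨β, fun β' => ⟨fun h => hanti.injective (h.trans hβ.symm), fun h => h ▸ hβ⟩⟩

theorem exists_sum_exp_eq_one (hd : 2 ≤ d) {L : Fin d → ℝ}
    (hL : (∀ i, 0 < L i) ∨ (∀ i, L i < 0)) :
    ∃ β : ℝ, ∀ β' : ℝ, ∑ k, Real.exp (-β' * L k) = 1 ↔ β' = β := by
  rcases hL with hL | hL
  · exact exists_sum_exp_eq_one_of_pos hd hL
  · obtain ⟨β, hβ⟩ := exists_sum_exp_eq_one_of_pos hd (L := fun i => -L i)
      fun i => neg_pos.2 (hL i)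
    -- Changing the signs of both β and L leaves the equation unchanged.
    refine ⟨-β, fun β' => ?_⟩
    have := hβ (-β')
    simp only [neg_neg, mul_neg] at this
    simp only [neg_mul, this, neg_eq_iff_eq_neg]

theorem same_sign_of_mul_pos (hd : 2 ≤ d) {L : Fin d → ℝ} {β : ℝ} (h : ∀ i, 0 < β * L i) :
    (∀ i, 0 < L i) ∨ (∀ i, L i < 0) := by
  rcases lt_trichotomy β 0 with hβ | hβ | hβ
  · exact Or.inr fun i => neg_of_mul_pos_right (h i) hβ.le
  · have := h ⟨0, by omega⟩
    simp [hβ] at this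
  · exact Or.inl fun i => (pos_iff_pos_of_mul_pos (h i)).1 hβ

end CuntzAlgebra
end Cuntz

/-! ### Classification of the KMS states -/

theorem mainTheorem7 (d : ℕ) (hd : 2 ≤ d) (L : Fin d → ℝ) :
    ((∃ (β : ℝ) (ω : Cuntz.CuntzAlgebra d →L[ℂ] ℂ),
        Cuntz.IsKMSState (Cuntz.CuntzAlgebra.flow L) β ω) ↔
      ((∀ i, 0 < L i) ∨ (∀ i, L i < 0))) ∧
    (((∀ i, 0 < L i) ∨ (∀ i, L i < 0)) →
      ∃ β : ℝ,
        (∀ β' : ℝ, ∑ k, Real.exp (-β' * L k) = 1 ↔ β' = β) ∧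
        (∀ β' : ℝ, (∃ ω : Cuntz.CuntzAlgebra d →L[ℂ] ℂ,
          Cuntz.IsKMSState (Cuntz.CuntzAlgebra.flow L) β' ω) ↔ β' = β) ∧
        ∃ ω : Cuntz.CuntzAlgebra d →L[ℂ] ℂ,
          (∀ ω' : Cuntz.CuntzAlgebra d →L[ℂ] ℂ,
            Cuntz.IsKMSState (Cuntz.CuntzAlgebra.flow L) β ω' ↔ ω' = ω) ∧
          ∀ α γ : List (Fin d),
            ω (Cuntz.CuntzAlgebra.word α * star (Cuntz.CuntzAlgebra.word γ)) =
              if α = γ then ((Real.exp (-β * (α.map L).sum) : ℝ) : ℂ) else 0) := by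
  have hd0 : 0 < d := by omega
  refine ⟨⟨fun ⟨β, ω, hω⟩ => ?_, fun hL => ?_⟩, fun hL => ?_⟩
  · exact Cuntz.CuntzAlgebra.same_sign_of_mul_pos hd
      (Cuntz.CuntzAlgebra.mul_pos_of_sum_exp_eq_one hd
        (Cuntz.CuntzAlgebra.sum_exp_eq_one_of_isKMSState hω))
  · obtain ⟨β, hβ⟩ := Cuntz.CuntzAlgebra.exists_sum_exp_eq_one hd hL
    exact ⟨β, Cuntz.CuntzAlgebra.exists_isKMSState hd0 ((hβ β).2 rfl)⟩
  · obtain ⟨β, hβ⟩ := Cuntz.CuntzAlgebra.exists_sum_exp_eq_one hd hL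
    have hsum := (hβ β).2 rfl
    have hpos := Cuntz.CuntzAlgebra.mul_pos_of_sum_exp_eq_one hd hsum
    obtain ⟨ω, hω⟩ := Cuntz.CuntzAlgebra.exists_isKMSState hd0 hsum
    have hval := Cuntz.CuntzAlgebra.isKMSState_apply_words hω hpos
    refine ⟨β, hβ, fun β' => ⟨fun ⟨ω', hω'⟩ => ?_, fun h => ?_⟩, ω, fun ω' => ⟨fun hω' => ?_,
      fun h => h ▸ hω⟩, hval⟩
    · exact (hβ β').1 (Cuntz.CuntzAlgebra.sum_exp_eq_one_of_isKMSState hω')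
    · exact h ▸ ⟨ω, hω⟩
    · refine ContinuousLinearMap.coe_injective
        (Cuntz.CuntzAlgebra.eq_of_eq_on_words ω'.continuous ω.continuous fun α γ => ?_)
      exact (Cuntz.CuntzAlgebra.isKMSState_apply_words hω' hpos α γ).trans (hval α γ).symm
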